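/- Let $n \ge 0$, let $\eta_0,\dots,\eta_n$ be independent standard complex normal random variables on a probability space (each has density $\frac1\pi e^{-|z|^2}$ on $\mathbb{C}$), and let $\phi_0,\dots,\phi_n$ be polynomials with complex coefficients, $\deg\phi_j=j$ and $\phi_0=1$. Put $\Phi_n(z)=\sum_{j=0}^n \eta_j\phi_j(z)$ and, for integers $k,l\ge 0$, $$K_n^{(k,l)}(z,w)=\sum_{j=0}^n \phi_j^{(k)}(z)\,\overline{\phi_j^{(l)}(w)},\qquad K_n=K_n^{(0,0)}.$$ Let $v\in\mathbb{C}$, let $\Theta\subseteq\mathbb{C}$ be a domain (a nonempty connected open set, not necessarily bounded), and let $N_\Theta^{\Phi_n,v}$ be the number of roots of the equation $\Phi_n(z)=v$ in $\Theta$, counted with multiplicity. Then $N_\Theta^{\Phi_n,v}$ is integrable, the function $$\rho_{n,v}(z)=\frac1\pi\left[\frac{K_n^{(1,1)}(z,z)}{K_n(z,z)}-\frac{|K_n^{(0,1)}(z,z)|^2}{K_n(z,z)^2}\left(1-\frac{|v|^2}{K_n(z,z)}\right)\right]\exp\left(-\frac{|v|^2}{K_n(z,z)}\right)$$ is integrable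 over $\Theta$, and $$\mathbb{E}\left[N_\Theta^{\Phi_n,v}\right]=\iint_\Theta \rho_{n,v}(z)\,dx\,dy .$$ -/

import Mathlib

open Polynomial MeasureTheory ProbabilityTheory
open scoped ComplexConjugate ENNReal

/-- The law of a standard complex normal random variable: the measure on the complex plane with
density `z ↦ (1 / π) * exp (-|z| ^ 2)` with respect to Lebesgue measure (mean `0`, and the expected
value of `|η| ^ 2` is `1`). -/
noncomputable def stdComplexNormal : Measure ℂ :=
  (volume : Measure ℂ).withDensity
    (fun z => ENNReal.ofReal (1 / Real.pi * Real.exp (-‖z‖ ^ 2)))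

/-- The random polynomial `Φ_n = ∑_{j = 0}^{n} η_j φ_j` at the sample point `ω`. -/
noncomputable def randomPoly {Ω : Type*} {n : ℕ} (φ : Fin (n + 1) → ℂ[X])
    (η : Fin (n + 1) → Ω → ℂ) (ω : Ω) : ℂ[X] :=
  ∑ j, C (η j ω) * φ j

open scoped Classical in
/-- The number of roots, counted with multiplicity, of the equation `p (z) = v` with `z ∈ Θ`.
(If `p` is the constant polynomial `v`, then `roots` is empty by convention; for the random
polynomial this event has probability zero.) -/
noncomputable def rootCount (p : ℂ[X]) (v : ℂ) (Θ : Set ℂ) : ℕ :=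
  ((p - C v).roots.filter (fun z => z ∈ Θ)).card

/-- `K_n^{(k, l)} (z, w) = ∑_{j = 0}^{n} φ_j^{(k)} (z) * conj (φ_j^{(l)} (w))`. -/
noncomputable def kernelDeriv {n : ℕ} (φ : Fin (n + 1) → ℂ[X]) (k l : ℕ) (z w : ℂ) : ℂ :=
  ∑ j, (derivative^[k] (φ j)).eval z * conj ((derivative^[l] (φ j)).eval w)

/-- The reproducing kernel `K_n (z, w) = ∑_{j = 0}^{n} φ_j (z) * conj (φ_j (w))`. -/
noncomputable def kernel {n : ℕ} (φ : Fin (n + 1) → ℂ[X]) (z w : ℂ) : ℂ :=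
  kernelDeriv φ 0 0 z w

/-- On the diagonal `K_n^{(k, k)} (z, z)` is a real number, so that taking its real part in
`rootDensity` loses nothing. -/
theorem kernelDeriv_self_eq_re {n : ℕ} (φ : Fin (n + 1) → ℂ[X]) (k : ℕ) (z : ℂ) :
    kernelDeriv φ k k z z = ((kernelDeriv φ k k z z).re : ℂ) := by
  simp only [kernelDeriv, Complex.mul_conj, ← Complex.ofReal_sum, Complex.ofReal_re]

/-- The density `ρ_{n, v}`. The diagonal values `K_n (z, z)` and `K_n^{(1, 1)} (z, z)` are real,
and are read as real numbers here. -/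
noncomputable def rootDensity {n : ℕ} (φ : Fin (n + 1) → ℂ[X]) (v z : ℂ) : ℝ :=
  1 / Real.pi *
    ((kernelDeriv φ 1 1 z z).re / (kernel φ z z).re
      - ‖kernelDeriv φ 0 1 z z‖ ^ 2 / (kernel φ z z).re ^ 2
        * (1 - ‖v‖ ^ 2 / (kernel φ z z).re))
    * Real.exp (-(‖v‖ ^ 2 / (kernel φ z z).re))

/-! As `φ 0 = 1`, the equation `Φ_n(z) = v` says `η_0 = p_t(z)`, where `p_t = v - ∑_{j ≥ 1} t_j φ_j`
and `t = (η_1, …, η_n)` is independent of `η_0`. For fixed `t`, the area formula for `p_t`, whose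
real Jacobian is `|p_t'|^2`, turns the mean number of simple solutions over the Gaussian value `η_0`
into the integral over `Θ` of `|p_t'(z)|^2 g(p_t(z))`, with `g` the standard Gaussian density
(`Polynomial.lintegral_encard_simple_roots_mul`). Critical values form a null set, so almost surely
every root is simple and multiplicities do not matter (`ae_eval_derivative_fiberPoly_ne_zero`).

Tonelli then leaves, at each `z`, a Gaussian integral over `t`: the density of `Φ_n(z)` at `v` times
the conditional mean of `|Φ_n'(z)|^2` given `Φ_n(z) = v`. `lintegral_pi_affine_mul_gaussDensity`
evaluates it to `ρ_{n,v}(z)`. Integrability follows from the bound `N ≤ n`. -/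

/-! ### Gaussian integrals in the plane -/

/-- The density of the centred complex normal law of variance `s`. -/
noncomputable def gaussDensity (s : ℝ) (w : ℂ) : ℝ :=
  1 / (Real.pi * s) * Real.exp (-(‖w‖ ^ 2 / s))

theorem gaussDensity_nonneg {s : ℝ} (hs : 0 < s) (w : ℂ) : 0 ≤ gaussDensity s w := by
  unfold gaussDensity; positivity

theorem continuous_gaussDensity (s : ℝ) : Continuous (gaussDensity s) := by
  unfold gaussDensity; fun_prop

theorem integral_gaussDensity {s : ℝ} (hs : 0 < s) : ∫ w, gaussDensity s w = 1 := by
  have h := Complex.integral_exp_neg_mul_rpow (p := 2) (b := 1 / s) (by norm_num) (by positivity)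
  unfold gaussDensity
  rw [integral_const_mul]
  have e : ∀ w : ℂ, Real.exp (-(‖w‖ ^ 2 / s)) = Real.exp (-(1 / s) * ‖w‖ ^ (2 : ℝ)) := by
    intro w; rw [Real.rpow_two]; congr 1; ring
  simp_rw [e, h]
  have e2 : (-2 / 2 : ℝ) = -1 := by norm_num
  have e3 : (2 / 2 + 1 : ℝ) = 2 := by norm_num
  rw [e2, e3, Real.Gamma_two, Real.rpow_neg_one]
  field_simp

theorem integral_normSq_mul_gaussDensity {s : ℝ} (hs : 0 < s) :
    ∫ w, ‖w‖ ^ 2 * gaussDensity s w = s := by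
  have h := Complex.integral_rpow_mul_exp_neg_mul_rpow (p := 2) (q := 2) (b := 1 / s)
    (by norm_num) (by norm_num) (by positivity)
  have e : ∀ w : ℂ, ‖w‖ ^ 2 * gaussDensity s w =
      1 / (Real.pi * s) * (‖w‖ ^ (2 : ℝ) * Real.exp (-(1 / s) * ‖w‖ ^ (2 : ℝ))) := by
    intro w; rw [Real.rpow_two, gaussDensity]
    rw [show -(1 / s) * ‖w‖ ^ 2 = -(‖w‖ ^ 2 / s) by ring]; ring
  simp_rw [e]
  rw [integral_const_mul, h]
  have e2 : (-(2 + 2) / 2 : ℝ) = -((2 : ℕ) : ℝ) := by norm_num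
  have e3 : ((2 + 2) / 2 : ℝ) = 2 := by norm_num
  rw [e2, e3, Real.Gamma_two, Real.rpow_neg (by positivity), Real.rpow_natCast]
  field_simp

/-- A non-integrable function has integral `0` by convention, so a nonzero value certifies
integrability. -/
theorem integrable_gaussDensity {s : ℝ} (hs : 0 < s) : Integrable (gaussDensity s) :=
  .of_integral_ne_zero (by rw [integral_gaussDensity hs]; exact one_ne_zero)

theorem integrable_normSq_mul_gaussDensity {s : ℝ} (hs : 0 < s) :
    Integrable (fun w : ℂ => ‖w‖ ^ 2 * gaussDensity s w) :=
  .of_integral_ne_zero (by rw [integral_normSq_mul_gaussDensity hs]; exact hs.ne')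

theorem gaussDensity_neg (s : ℝ) (w : ℂ) : gaussDensity s (-w) = gaussDensity s w := by
  simp [gaussDensity]

theorem lintegral_affine_mul_gaussDensity {s α : ℝ} (hs : 0 < s) (hα : 0 ≤ α) (b c : ℂ) :
    ∫⁻ t, ENNReal.ofReal ((α + ‖c + b * t‖ ^ 2) * gaussDensity s t) =
      ENNReal.ofReal (α + ‖c‖ ^ 2 + ‖b‖ ^ 2 * s) := by
  have hexp : ∀ t : ℂ, (α + ‖c + b * t‖ ^ 2) * gaussDensity s t =
      ((α + ‖c‖ ^ 2) * gaussDensity s t + ‖b‖ ^ 2 * (‖t‖ ^ 2 * gaussDensity s t)) +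
        2 * (c * conj (b * t)).re * gaussDensity s t := by
    intro t
    have : ‖c + b * t‖ ^ 2 = ‖c‖ ^ 2 + ‖b‖ ^ 2 * ‖t‖ ^ 2 + 2 * (c * conj (b * t)).re := by
      rw [← mul_pow, ← norm_mul, ← Complex.normSq_eq_norm_sq, ← Complex.normSq_eq_norm_sq,
        ← Complex.normSq_eq_norm_sq, Complex.normSq_add]
    rw [this]; ring
  have hi1 := (integrable_gaussDensity hs).const_mul (α + ‖c‖ ^ 2)
  have hi2 := (integrable_normSq_mul_gaussDensity hs).const_mul (‖b‖ ^ 2)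
  have hi12 : Integrable fun t : ℂ =>
      (α + ‖c‖ ^ 2) * gaussDensity s t + ‖b‖ ^ 2 * (‖t‖ ^ 2 * gaussDensity s t) := hi1.add hi2
  have hi3 : Integrable fun t : ℂ => 2 * (c * conj (b * t)).re * gaussDensity s t := by
    -- By AM-GM the cross term is dominated by the two square terms.
    refine Integrable.mono' hi12 ?_ (.of_forall fun t => ?_)
    · have := continuous_gaussDensity s
      exact Continuous.aestronglyMeasurable (by fun_prop)
    · have h1 : |(c * conj (b * t)).re| ≤ ‖c‖ * (‖b‖ * ‖t‖) := by
        refine (Complex.abs_re_le_norm _).trans (by simp)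
      rw [Real.norm_eq_abs, abs_mul, abs_of_nonneg (gaussDensity_nonneg hs t), abs_mul, abs_two]
      have := gaussDensity_nonneg hs t
      have h2 : 2 * |(c * conj (b * t)).re| ≤ α + ‖c‖ ^ 2 + ‖b‖ ^ 2 * ‖t‖ ^ 2 := by
        nlinarith [sq_nonneg (‖c‖ - ‖b‖ * ‖t‖)]
      calc _ ≤ (α + ‖c‖ ^ 2 + ‖b‖ ^ 2 * ‖t‖ ^ 2) * gaussDensity s t := by gcongr
        _ = _ := by ring
  have hodd : ∫ t : ℂ, 2 * (c * conj (b * t)).re * gaussDensity s t = 0 := by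
    have := integral_neg_eq_self (fun t : ℂ => 2 * (c * conj (b * t)).re * gaussDensity s t) volume
    simp only [gaussDensity_neg, mul_neg, map_neg, Complex.neg_re, neg_mul, integral_neg] at this
    simp only [map_mul] at this ⊢
    linarith
  simp_rw [hexp]
  refine (ofReal_integral_eq_lintegral_ofReal (hi12.add hi3) ?_).symm.trans ?_
  rotate_left
  · rw [integral_add' hi12 hi3, hodd, integral_add hi1 hi2, integral_const_mul,
      integral_const_mul, integral_gaussDensity hs, integral_normSq_mul_gaussDensity hs]
    congr 1; ring
  · refine .of_forall fun t => ?_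
    have := gaussDensity_nonneg hs t
    simp only [Pi.add_apply, Pi.zero_apply]
    rw [← hexp]
    positivity

theorem lintegral_affine_mul_gaussDensity_sub {s α : ℝ} (hs : 0 < s) (hα : 0 ≤ α) (b c m : ℂ) :
    ∫⁻ t, ENNReal.ofReal ((α + ‖c + b * t‖ ^ 2) * gaussDensity s (t - m)) =
      ENNReal.ofReal (α + ‖c + b * m‖ ^ 2 + ‖b‖ ^ 2 * s) := by
  rw [← lintegral_affine_mul_gaussDensity hs hα,
    ← lintegral_sub_right_eq_self (fun t => ENNReal.ofReal ((α + ‖c + b * m + b * t‖ ^ 2) * _)) m]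
  refine lintegral_congr fun t => ?_
  rw [show c + b * m + b * (t - m) = c + b * t by ring]

/-- Completing the square: the joint density of `t` and `u = a t + noise` is the marginal of `u`
times the conditional density of `t` given `u`. -/
theorem gaussDensity_sub_mul_gaussDensity_one {s : ℝ} (hs : 0 < s) (a u t : ℂ) :
    gaussDensity s (u - a * t) * gaussDensity 1 t =
      gaussDensity (s + ‖a‖ ^ 2) u *
        gaussDensity (s / (s + ‖a‖ ^ 2)) (t - conj a * u / ((s + ‖a‖ ^ 2 : ℝ) : ℂ)) := by
  have hS : 0 < s + ‖a‖ ^ 2 := by positivity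
  set S := s + ‖a‖ ^ 2 with hSd
  have key : ‖u - a * t‖ ^ 2 / s + ‖t‖ ^ 2 / 1 =
      ‖u‖ ^ 2 / S + ‖t - conj a * u / (S : ℂ)‖ ^ 2 / (s / S) := by
    have e : ‖t - conj a * u / (S : ℂ)‖ ^ 2 = ‖S * t - conj a * u‖ ^ 2 / S ^ 2 := by
      rw [← div_pow, ← Real.norm_of_nonneg hS.le, ← Complex.norm_real, ← norm_div,
        Complex.norm_real, Real.norm_of_nonneg hS.le]
      congr 2
      have : (S : ℂ) ≠ 0 := by exact_mod_cast hS.ne'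
      field_simp
    rw [e]
    have ha : ‖a‖ ^ 2 = a.re * a.re + a.im * a.im := by
      rw [← Complex.normSq_eq_norm_sq, Complex.normSq_apply]
    have hs' : s = S - (a.re * a.re + a.im * a.im) := by rw [hSd, ha]; ring
    field_simp
    simp only [← Complex.normSq_eq_norm_sq, Complex.normSq_apply, Complex.sub_re, Complex.sub_im,
      Complex.mul_re, Complex.mul_im, Complex.ofReal_re, Complex.ofReal_im, Complex.conj_re,
      Complex.conj_im]
    rw [hs']
    ring
  unfold gaussDensity
  rw [mul_mul_mul_comm, mul_mul_mul_comm (1 / (Real.pi * S)), ← Real.exp_add, ← Real.exp_add,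
    ← neg_add, ← neg_add, key]
  congr 1
  field_simp

theorem stdComplexNormal_eq :
    stdComplexNormal = volume.withDensity fun z => ENNReal.ofReal (gaussDensity 1 z) := by
  simp [stdComplexNormal, gaussDensity]

theorem measurable_ofReal_gaussDensity (s : ℝ) :
    Measurable fun z => ENNReal.ofReal (gaussDensity s z) :=
  (continuous_gaussDensity s).measurable.ennreal_ofReal

instance : IsProbabilityMeasure stdComplexNormal := by
  refine ⟨?_⟩
  rw [stdComplexNormal_eq, withDensity_apply _ .univ, Measure.restrict_univ,
    ← ofReal_integral_eq_lintegral_ofReal (integrable_gaussDensity one_pos)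
      (.of_forall (gaussDensity_nonneg one_pos)), integral_gaussDensity one_pos, ENNReal.ofReal_one]

theorem lintegral_affine_mul_gaussDensity_stdComplexNormal {s α : ℝ} (hs : 0 < s) (hα : 0 ≤ α)
    (a b c u : ℂ) :
    ∫⁻ t, ENNReal.ofReal ((α + ‖c + b * t‖ ^ 2) * gaussDensity s (u - a * t))
        ∂stdComplexNormal =
      ENNReal.ofReal ((α + ‖c + b * (conj a * u / ((s + ‖a‖ ^ 2 : ℝ) : ℂ))‖ ^ 2 +
        ‖b‖ ^ 2 * (s / (s + ‖a‖ ^ 2))) * gaussDensity (s + ‖a‖ ^ 2) u) := by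
  have hS : 0 < s + ‖a‖ ^ 2 := by positivity
  have := continuous_gaussDensity s
  rw [stdComplexNormal_eq, lintegral_withDensity_eq_lintegral_mul _
    (measurable_ofReal_gaussDensity 1) (by fun_prop), mul_comm (_ + _),
    ENNReal.ofReal_mul (gaussDensity_nonneg hS u),
    ← lintegral_affine_mul_gaussDensity_sub (div_pos hs hS) hα, ← lintegral_const_mul]
  · refine lintegral_congr fun t => ?_
    rw [Pi.mul_apply, ← ENNReal.ofReal_mul (gaussDensity_nonneg one_pos t),
      ← ENNReal.ofReal_mul (gaussDensity_nonneg hS u)]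
    congr 1
    linear_combination (α + ‖c + b * t‖ ^ 2) * gaussDensity_sub_mul_gaussDensity_one hs a u t
  · have := continuous_gaussDensity (s / (s + ‖a‖ ^ 2))
    fun_prop

/-! ### Gaussian regression in several variables -/

theorem norm_sum_mul_conj_sq_le {ι : Type*} (I : Finset ι) (a b : ι → ℂ) :
    ‖∑ j ∈ I, b j * conj (a j)‖ ^ 2 ≤ (∑ j ∈ I, ‖b j‖ ^ 2) * ∑ j ∈ I, ‖a j‖ ^ 2 := by
  refine le_trans ?_ (Finset.sum_mul_sq_le_sq_mul_sq I _ _)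
  gcongr
  exact (norm_sum_le _ _).trans_eq (by simp)

/-- The Gaussian regression identity behind the Kac-Rice formula. -/
theorem lintegral_pi_affine_mul_gaussDensity (m : ℕ) (a b : Fin m → ℂ) (c u : ℂ) :
    ∫⁻ t, ENNReal.ofReal (‖c + ∑ j, b j * t j‖ ^ 2 * gaussDensity 1 (u - ∑ j, a j * t j))
        ∂Measure.pi (fun _ : Fin m => stdComplexNormal) =
      ENNReal.ofReal
        ((∑ j, ‖b j‖ ^ 2 - ‖∑ j, b j * conj (a j)‖ ^ 2 / (1 + ∑ j, ‖a j‖ ^ 2) +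
          ‖c + (∑ j, b j * conj (a j)) / ((1 + ∑ j, ‖a j‖ ^ 2 : ℝ) : ℂ) * u‖ ^ 2) *
          gaussDensity (1 + ∑ j, ‖a j‖ ^ 2) u) := by
  induction m generalizing c u with
  | zero => simp [lintegral_unique]
  | succ m ih =>
    -- Coordinate `0` is split off. With `x = t 0` fixed, the induction hypothesis applies with `c`
    -- and `u` shifted, which is why both are generalized.
    have hmp := (measurePreserving_piFinSuccAbove (fun _ : Fin (m + 1) => stdComplexNormal) 0).symm
    rw [← hmp.lintegral_comp_emb (MeasurableEquiv.measurableEmbedding _)]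
    have := continuous_gaussDensity 1
    rw [lintegral_prod _ (by
      refine Measurable.aemeasurable ?_
      refine Measurable.comp (g := fun t : Fin (m + 1) → ℂ => ENNReal.ofReal
        (‖c + ∑ j, b j * t j‖ ^ 2 * gaussDensity 1 (u - ∑ j, a j * t j))) ?_
        (MeasurableEquiv.measurable _)
      fun_prop)]
    set A : ℝ := ∑ j : Fin m, ‖a j.succ‖ ^ 2 with hA
    set B : ℂ := ∑ j : Fin m, b j.succ * conj (a j.succ) with hB
    set D : ℝ := ∑ j : Fin m, ‖b j.succ‖ ^ 2 with hD
    have hA0 : 0 ≤ A := by positivity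
    -- The residual variance is nonnegative by Cauchy-Schwarz.
    have hα : 0 ≤ D - ‖B‖ ^ 2 / (1 + A) := by
      have h1 := norm_sum_mul_conj_sq_le Finset.univ (fun j : Fin m => a j.succ) fun j => b j.succ
      rw [← hA, ← hB, ← hD] at h1
      have hD0 : 0 ≤ D := by positivity
      rw [sub_nonneg, div_le_iff₀ (by positivity)]
      nlinarith
    have hin : ∀ x : ℂ, ∫⁻ y, ENNReal.ofReal
        (‖c + ∑ j, b j * (MeasurableEquiv.piFinSuccAbove (fun _ => ℂ) 0).symm (x, y) j‖ ^ 2 *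
          gaussDensity 1
            (u - ∑ j, a j * (MeasurableEquiv.piFinSuccAbove (fun _ => ℂ) 0).symm (x, y) j))
        ∂Measure.pi (fun _ : Fin m => stdComplexNormal) =
        ENNReal.ofReal ((D - ‖B‖ ^ 2 / (1 + A) +
          ‖(c + B / ((1 + A : ℝ) : ℂ) * u) + (b 0 - B / ((1 + A : ℝ) : ℂ) * a 0) * x‖ ^ 2) *
          gaussDensity (1 + A) (u - a 0 * x)) := by
      intro x
      have h := ih (fun j => a j.succ) (fun j => b j.succ) (c + b 0 * x) (u - a 0 * x)
      rw [← hA, ← hB, ← hD] at h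
      rw [show (c + B / ((1 + A : ℝ) : ℂ) * u) + (b 0 - B / ((1 + A : ℝ) : ℂ) * a 0) * x =
        c + b 0 * x + B / ((1 + A : ℝ) : ℂ) * (u - a 0 * x) by ring, ← h]
      refine lintegral_congr fun y => ?_
      simp [Fin.sum_univ_succ, MeasurableEquiv.piFinSuccAbove, Fin.insertNthEquiv, add_assoc, sub_sub]
    simp only at hin ⊢
    rw [lintegral_congr hin, lintegral_affine_mul_gaussDensity_stdComplexNormal (by positivity) hα]
    have hs : 0 < 1 + A := by positivity
    have hS : 0 < 1 + A + ‖a 0‖ ^ 2 := by positivity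
    have e1 : 1 + ∑ j, ‖a j‖ ^ 2 = 1 + A + ‖a 0‖ ^ 2 := by rw [Fin.sum_univ_succ, hA]; ring
    have e2 : ∑ j, b j * conj (a j) = B + b 0 * conj (a 0) := by
      rw [Fin.sum_univ_succ, hB]; ring
    have e3 : ∑ j, ‖b j‖ ^ 2 = D + ‖b 0‖ ^ 2 := by rw [Fin.sum_univ_succ, hD]; ring
    rw [e1, e2, e3]
    congr 2
    have hcs : ((1 + A : ℝ) : ℂ) ≠ 0 := by exact_mod_cast hs.ne'
    have hcS : ((1 + A + ‖a 0‖ ^ 2 : ℝ) : ℂ) ≠ 0 := by exact_mod_cast hS.ne'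
    have haa : a 0 * conj (a 0) = ((1 + A + ‖a 0‖ ^ 2 : ℝ) : ℂ) - ((1 + A : ℝ) : ℂ) := by
      rw [Complex.mul_conj']; push_cast; ring
    have f1 : c + B / ((1 + A : ℝ) : ℂ) * u + (b 0 - B / ((1 + A : ℝ) : ℂ) * a 0) *
        (conj (a 0) * u / ((1 + A + ‖a 0‖ ^ 2 : ℝ) : ℂ)) =
        c + (B + b 0 * conj (a 0)) / ((1 + A + ‖a 0‖ ^ 2 : ℝ) : ℂ) * u := by
      have : B / ((1 + A : ℝ) : ℂ) * a 0 * conj (a 0) =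
        B / ((1 + A : ℝ) : ℂ) * (((1 + A + ‖a 0‖ ^ 2 : ℝ) : ℂ) - ((1 + A : ℝ) : ℂ)) := by
          rw [mul_assoc, haa]
      field_simp at this ⊢
      linear_combination (-u) * this
    have f2 : ‖b 0 - B / ((1 + A : ℝ) : ℂ) * a 0‖ ^ 2 * ((1 + A) / (1 + A + ‖a 0‖ ^ 2)) =
        ‖B‖ ^ 2 / (1 + A) + ‖b 0‖ ^ 2 - ‖B + b 0 * conj (a 0)‖ ^ 2 / (1 + A + ‖a 0‖ ^ 2) := by
      have e : ‖b 0 - B / ((1 + A : ℝ) : ℂ) * a 0‖ ^ 2 =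
          ‖((1 + A : ℝ) : ℂ) * b 0 - B * a 0‖ ^ 2 / (1 + A) ^ 2 := by
        rw [← div_pow, ← Real.norm_of_nonneg hs.le, ← Complex.norm_real, ← norm_div,
          Complex.norm_real, Real.norm_of_nonneg hs.le]
        congr 2
        field_simp
      rw [e]
      clear_value A B D
      -- This makes `1 + A` a single atom for `field_simp` and `ring`.
      obtain ⟨s, rfl⟩ : ∃ s, A = s - 1 := ⟨A + 1, by ring⟩
      simp only [add_sub_cancel] at hs hS ⊢
      generalize a 0 = x at *
      generalize b 0 = y at *
      field_simp
      simp only [← Complex.normSq_eq_norm_sq, Complex.normSq_apply, Complex.sub_re, Complex.sub_im,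
        Complex.mul_re, Complex.mul_im, Complex.ofReal_re, Complex.ofReal_im, Complex.conj_re,
        Complex.conj_im, Complex.add_re, Complex.add_im]
      ring
    rw [f1, add_assoc, add_comm (‖_‖ ^ 2), f2]
    ring

/-! ### Fibre counting and the area formula -/

/-- Lindelöf gives a countable cover by injectivity neighbourhoods, which is then made disjoint. -/
theorem exists_measurable_partition_injOn {X Y : Type*} [TopologicalSpace X]
    [SecondCountableTopology X] [MeasurableSpace X] [OpensMeasurableSpace X] {f : X → Y}
    {U : Set X} (hU : MeasurableSet U) (hf : ∀ x ∈ U, ∃ V, IsOpen V ∧ x ∈ V ∧ Set.InjOn f V) :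
    ∃ S : ℕ → Set X, (∀ i, MeasurableSet (S i)) ∧ Pairwise (Function.onFun Disjoint S) ∧
      ⋃ i, S i = U ∧ ∀ i, Set.InjOn f (S i) := by
  obtain ⟨T, hTc, hTsub, hT⟩ := TopologicalSpace.isOpen_sUnion_countable
    {V : Set X | IsOpen V ∧ Set.InjOn f V} fun V hV => hV.1
  -- Adding `∅` makes the countable family nonempty, hence enumerable by `ℕ`.
  obtain ⟨V, hV⟩ := (hTc.insert ∅).exists_eq_range (Set.insert_nonempty _ _)
  have hVT : ∀ i, V i ∈ insert ∅ T := fun i => hV ▸ Set.mem_range_self i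
  have hVo : ∀ i, IsOpen (V i) ∧ Set.InjOn f (V i) := fun i => by
    rcases hVT i with h | h
    · rw [h]; exact ⟨isOpen_empty, Set.injOn_empty f⟩
    · exact hTsub h
  refine ⟨disjointed fun i => V i ∩ U, fun i => ?_, disjoint_disjointed _, ?_, fun i => ?_⟩
  · exact MeasurableSet.disjointed (fun j => (hVo j).1.measurableSet.inter hU) i
  · rw [iUnion_disjointed, ← Set.iUnion_inter, Set.inter_eq_right]
    intro x hx
    obtain ⟨W, hWo, hxW, hWi⟩ := hf x hx
    have : x ∈ ⋃₀ T := hT ▸ ⟨W, ⟨hWo, hWi⟩, hxW⟩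
    obtain ⟨W', hW', hxW'⟩ := this
    have : W' ∈ Set.range V := hV ▸ Set.mem_insert_of_mem _ hW'
    obtain ⟨i, rfl⟩ := this
    exact Set.mem_iUnion.2 ⟨i, hxW'⟩
  · exact (hVo i).2.mono ((disjointed_subset _ i).trans Set.inter_subset_left)

/-- Each piece meets a fibre in at most one point. -/
theorem encard_inter_fiber_eq_tsum {X Y : Type*} {f : X → Y} {S : ℕ → Set X}
    (hd : Pairwise (Function.onFun Disjoint S)) (hinj : ∀ i, Set.InjOn f (S i)) (y : Y) :
    (((⋃ i, S i) ∩ f ⁻¹' {y}).encard : ℝ≥0∞) = ∑' i, (f '' S i).indicator 1 y := by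
  let _ : MeasurableSpace X := ⊤
  rw [← Measure.count_apply MeasurableSpace.measurableSet_top, Set.iUnion_inter,
    measure_iUnion (fun i j hij => (hd hij).mono Set.inter_subset_left Set.inter_subset_left)
      fun i => MeasurableSpace.measurableSet_top]
  refine tsum_congr fun i => ?_
  by_cases hy : y ∈ f '' S i
  · obtain ⟨x, hx, rfl⟩ := hy
    rw [Set.indicator_of_mem (Set.mem_image_of_mem f hx), Pi.one_apply,
      show S i ∩ f ⁻¹' {f x} = {x} from ?_, Measure.count_singleton]
    ext z
    refine ⟨fun hz => hinj i hz.1 hx hz.2, ?_⟩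
    rintro rfl
    exact ⟨hx, rfl⟩
  · rw [Set.indicator_of_notMem hy, show S i ∩ f ⁻¹' {y} = ∅ from ?_, measure_empty]
    ext z
    simp only [Set.mem_inter_iff, Set.mem_preimage, Set.mem_singleton_iff, Set.mem_empty_iff_false,
      iff_false, not_and]
    exact fun hz hzy => hy ⟨z, hz, hzy⟩

/-- By Lusin-Souslin, injective continuous images of Borel sets are Borel. -/
theorem measurable_encard_inter_fiber {X Y : Type*} [TopologicalSpace X] [PolishSpace X]
    [MeasurableSpace X] [BorelSpace X] [TopologicalSpace Y] [T2Space Y] [MeasurableSpace Y]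
    [OpensMeasurableSpace Y] [SecondCountableTopology Y] {f : X → Y} (hfc : Continuous f)
    {U : Set X} (hU : MeasurableSet U)
    (hf : ∀ x ∈ U, ∃ V, IsOpen V ∧ x ∈ V ∧ Set.InjOn f V) :
    Measurable fun y => ((U ∩ f ⁻¹' {y}).encard : ℝ≥0∞) := by
  obtain ⟨S, hS, hd, rfl, hinj⟩ := exists_measurable_partition_injOn hU hf
  simp_rw [encard_inter_fiber_eq_tsum hd hinj]
  exact Measurable.tsum fun i => measurable_one.indicator
    ((hS i).image_of_continuousOn_injOn hfc.continuousOn (hinj i))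

/-- The area formula, on a set where the map is locally injective. -/
theorem lintegral_encard_inter_fiber_mul {E : Type*} [NormedAddCommGroup E] [NormedSpace ℝ E]
    [FiniteDimensional ℝ E] [MeasurableSpace E] [BorelSpace E] (μ : Measure E)
    [μ.IsAddHaarMeasure] {f : E → E} {f' : E → E →L[ℝ] E} {U : Set E} (hU : MeasurableSet U)
    (hf' : ∀ x ∈ U, HasFDerivAt f (f' x) x)
    (hf : ∀ x ∈ U, ∃ V, IsOpen V ∧ x ∈ V ∧ Set.InjOn f V) {h : E → ℝ≥0∞} (hh : Measurable h) :
    ∫⁻ y, ((U ∩ f ⁻¹' {y}).encard : ℝ≥0∞) * h y ∂μ =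
      ∫⁻ x in U, ENNReal.ofReal |(f' x).det| * h (f x) ∂μ := by
  have : ProperSpace E := FiniteDimensional.proper_real E
  obtain ⟨S, hS, hd, rfl, hinj⟩ := exists_measurable_partition_injOn hU hf
  have hSf : ∀ i, ∀ x ∈ S i, HasFDerivWithinAt f (f' x) (S i) x := fun i x hx =>
    (hf' x (Set.mem_iUnion_of_mem i hx)).hasFDerivWithinAt
  have him : ∀ i, MeasurableSet (f '' S i) := fun i =>
    measurable_image_of_fderivWithin (hS i) (hSf i) (hinj i)
  have hm : ∀ i, Measurable fun y => (f '' S i).indicator 1 y * h y := fun i =>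
    (measurable_one.indicator (him i)).mul hh
  simp_rw [encard_inter_fiber_eq_tsum hd hinj, ← ENNReal.tsum_mul_right]
  rw [lintegral_tsum fun i => (hm i).aemeasurable,
    lintegral_iUnion hS hd]
  refine tsum_congr fun i => ?_
  rw [← lintegral_image_eq_lintegral_abs_det_fderiv_mul μ (hS i) (hSf i) (hinj i),
    ← lintegral_indicator (him i)]
  refine lintegral_congr fun y => ?_
  by_cases hy : y ∈ f '' S i <;> simp [hy]

theorem HasStrictFDerivAt.exists_isOpen_injOn {𝕜 E : Type*} [NontriviallyNormedField 𝕜]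
    [CompleteSpace 𝕜] [NormedAddCommGroup E] [NormedSpace 𝕜 E] [FiniteDimensional 𝕜 E]
    {f : E → E} {f' : E →L[𝕜] E} {x : E} (hf : HasStrictFDerivAt f f' x)
    (hf' : Function.Injective f') : ∃ V, IsOpen V ∧ x ∈ V ∧ Set.InjOn f V := by
  have : CompleteSpace E := FiniteDimensional.complete 𝕜 E
  let e : E ≃L[𝕜] E := (LinearEquiv.ofInjectiveEndo (f' : E →ₗ[𝕜] E) hf').toContinuousLinearEquiv
  have he : HasStrictFDerivAt f (e : E →L[𝕜] E) x := by
    convert hf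
    ext y
    rfl
  exact ⟨_, (he.toOpenPartialHomeomorph f).open_source, he.mem_toOpenPartialHomeomorph_source,
    (he.toOpenPartialHomeomorph f).injOn⟩

/-! ### Polynomials as maps of the plane -/

theorem det_restrictScalars_toSpanSingleton (d : ℂ) :
    ((ContinuousLinearMap.toSpanSingleton ℂ d).restrictScalars ℝ).det = ‖d‖ ^ 2 := by
  simp [ContinuousLinearMap.det, LinearMap.det_restrictScalars, Algebra.norm_complex_eq,
    Complex.normSq_eq_norm_sq]

theorem Polynomial.hasFDerivAt_restrictScalars (p : ℂ[X]) (z : ℂ) :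
    HasFDerivAt (fun z => p.eval z)
      ((ContinuousLinearMap.toSpanSingleton ℂ (p.derivative.eval z)).restrictScalars ℝ) z :=
  (p.hasDerivAt z).hasFDerivAt.restrictScalars ℝ

/-- The area formula for a polynomial, counting simple roots. -/
theorem Polynomial.lintegral_encard_simple_roots_mul (p : ℂ[X]) {Θ : Set ℂ}
    (hΘ : MeasurableSet Θ) {h : ℂ → ℝ≥0∞} (hh : Measurable h) :
    ∫⁻ w, ({z | z ∈ Θ ∧ p.eval z = w ∧ p.derivative.eval z ≠ 0}.encard : ℝ≥0∞) * h w =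
      ∫⁻ z in Θ, ENNReal.ofReal (‖p.derivative.eval z‖ ^ 2) * h (p.eval z) := by
  have hcm : MeasurableSet {z | p.derivative.eval z ≠ 0} :=
    (isOpen_ne_fun p.derivative.continuous continuous_const).measurableSet
  have hU : MeasurableSet (Θ ∩ {z | p.derivative.eval z ≠ 0}) := hΘ.inter hcm
  have key := lintegral_encard_inter_fiber_mul volume hU
    (fun z _ => p.hasFDerivAt_restrictScalars z) (fun z hz => by
      refine HasStrictFDerivAt.exists_isOpen_injOn (p.hasStrictDerivAt z).hasStrictFDerivAt ?_
      intro a b hab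
      simpa [hz.2.out] using hab) hh
  simp_rw [det_restrictScalars_toSpanSingleton, abs_of_nonneg (sq_nonneg ‖_‖)] at key
  have hset : ∀ w, {z | z ∈ Θ ∧ p.eval z = w ∧ p.derivative.eval z ≠ 0} =
      (Θ ∩ {z | p.derivative.eval z ≠ 0}) ∩ (fun z => p.eval z) ⁻¹' {w} := by
    intro w; ext z; simp; tauto
  simp_rw [hset, key]
  rw [← lintegral_indicator hU, ← lintegral_indicator hΘ]
  refine lintegral_congr fun z => ?_
  by_cases h1 : z ∈ Θ <;> by_cases h2 : p.derivative.eval z = 0 <;>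
    simp [Set.indicator, h1, h2]

/-- The equidimensional case of Sard's theorem; constant polynomials are included. -/
theorem Polynomial.volume_critical_values (p : ℂ[X]) :
    volume ((fun z => p.eval z) '' {z | p.derivative.eval z = 0}) = 0 := by
  refine addHaar_image_eq_zero_of_det_fderivWithin_eq_zero volume
    (fun z _ => (p.hasFDerivAt_restrictScalars z).hasFDerivWithinAt) fun z hz => ?_
  rw [det_restrictScalars_toSpanSingleton, hz.out]
  simp

theorem Polynomial.card_roots_filter_eq_encard {q : ℂ[X]}
    (hq : ∀ z, q.eval z = 0 → q.derivative.eval z ≠ 0) (Θ : Set ℂ) [DecidablePred (· ∈ Θ)] :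
    ((q.roots.filter (· ∈ Θ)).card : ℝ≥0∞) =
      ({z | z ∈ Θ ∧ q.eval z = 0 ∧ q.derivative.eval z ≠ 0}.encard : ℝ≥0∞) := by
  have hq0 : q ≠ 0 := by
    rintro rfl
    simpa using hq 0
  have hnd : q.roots.Nodup := by
    rw [Multiset.nodup_iff_count_le_one]
    intro z
    rw [count_roots]
    by_contra! hz
    rw [one_lt_rootMultiplicity_iff_isRoot hq0] at hz
    exact hq z hz.1 hz.2
  have : {z | z ∈ Θ ∧ q.eval z = 0 ∧ q.derivative.eval z ≠ 0} =
      ((⟨q.roots.filter (· ∈ Θ), hnd.filter _⟩ : Finset ℂ) : Set ℂ) := by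
    ext z
    simp only [Set.mem_ofPred_eq, Finset.mem_coe, Finset.mem_mk, Multiset.mem_filter, mem_roots hq0,
      IsRoot.def]
    exact ⟨fun h => ⟨h.2.1, h.1⟩, fun h => ⟨h.2, h.1, hq z h.1⟩⟩
  rw [this, Set.encard_coe_eq_coe_finsetCard]
  rfl

/-! ### Reduction to the fibre polynomials -/

/-- `(z, t) ↦ (g (z, t), t)` is locally injective where the partial derivative of `g` in `z` does
not vanish. -/
theorem exists_isOpen_injOn_prodMk_snd {T : Type*} [NormedAddCommGroup T] [NormedSpace ℂ T]
    [FiniteDimensional ℂ T] {g : ℂ × T → ℂ} (hg : ContDiff ℂ 1 g) {d : ℂ} {x : ℂ × T}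
    (hd : HasDerivAt (fun z => g (z, x.2)) d x.1) (hd0 : d ≠ 0) :
    ∃ V, IsOpen V ∧ x ∈ V ∧ Set.InjOn (fun y : ℂ × T => (g y, y.2)) V := by
  have hs : HasStrictFDerivAt g (fderiv ℂ g x) x :=
    hg.contDiffAt.hasStrictFDerivAt one_ne_zero
  have hF := hs.prodMk (hasStrictFDerivAt_snd (𝕜 := ℂ) (p := x))
  refine hF.exists_isOpen_injOn ((injective_iff_map_eq_zero _).2 ?_)
  rintro ⟨a, b⟩ hab
  have h1 : fderiv ℂ g x (a, b) = 0 := congrArg Prod.fst hab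
  have h2 : b = 0 := congrArg Prod.snd hab
  subst h2
  have hcomp : HasDerivAt (fun z => g (z, x.2)) (fderiv ℂ g x (1, 0)) x.1 :=
    HasFDerivAt.comp_hasDerivAt x.1 hs.hasFDerivAt
      ((hasDerivAt_id x.1).prodMk (hasDerivAt_const x.1 x.2))
  have h3 : fderiv ℂ g x (a, 0) = a * d := by
    rw [← hcomp.unique hd, ← smul_eq_mul, ← map_smul]
    simp
  rw [h3] at h1
  simpa [hd0] using h1

/-- The polynomial `v - ∑_{j ≥ 1} t_j φ_j`, whose value at `z` is the value of the coefficient of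
`φ_0 = 1` for which the random polynomial takes the value `v` at `z`. -/
noncomputable def fiberPoly {n : ℕ} (φ : Fin (n + 1) → ℂ[X]) (v : ℂ) (t : Fin n → ℂ) : ℂ[X] :=
  C v - ∑ j, C (t j) * φ j.succ

theorem eval_fiberPoly {n : ℕ} (φ : Fin (n + 1) → ℂ[X]) (v : ℂ) (t : Fin n → ℂ) (z : ℂ) :
    (fiberPoly φ v t).eval z = v - ∑ j, (φ j.succ).eval z * t j := by
  simp [fiberPoly, eval_finsetSum, mul_comm]

theorem eval_derivative_fiberPoly {n : ℕ} (φ : Fin (n + 1) → ℂ[X]) (v : ℂ) (t : Fin n → ℂ)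
    (z : ℂ) :
    (fiberPoly φ v t).derivative.eval z = -∑ j, (φ j.succ).derivative.eval z * t j := by
  simp [fiberPoly, eval_finsetSum, mul_comm]

theorem Polynomial.contDiff_eval {T : Type*} [NormedAddCommGroup T] [NormedSpace ℂ T] (p : ℂ[X])
    {f : T → ℂ} (hf : ContDiff ℂ 1 f) : ContDiff ℂ 1 fun x => p.eval (f x) := by
  have h := (p.contDiff_aeval (𝕜 := ℂ) 1).comp hf
  simp only [coe_aeval_eq_eval] at h
  exact h

theorem contDiff_eval_fiberPoly {n : ℕ} (φ : Fin (n + 1) → ℂ[X]) (v : ℂ) :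
    ContDiff ℂ 1 fun x : ℂ × (Fin n → ℂ) => (fiberPoly φ v x.2).eval x.1 := by
  simp_rw [eval_fiberPoly]
  exact contDiff_const.sub (ContDiff.sum fun j _ =>
    ((φ j.succ).contDiff_eval contDiff_fst).mul ((contDiff_apply ℂ ℂ j).comp contDiff_snd))

theorem continuous_eval_derivative_fiberPoly {n : ℕ} (φ : Fin (n + 1) → ℂ[X]) (v : ℂ) :
    Continuous fun x : ℂ × (Fin n → ℂ) => (fiberPoly φ v x.2).derivative.eval x.1 := by
  simp_rw [eval_derivative_fiberPoly]
  fun_prop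

/-- The number of points `z` of `Θ` with `v - ∑_{j ≥ 1} t_j φ_j (z) = w` at which the derivative of
the left-hand side does not vanish. -/
noncomputable def simpleCount {n : ℕ} (φ : Fin (n + 1) → ℂ[X]) (v : ℂ) (Θ : Set ℂ)
    (y : ℂ × (Fin n → ℂ)) : ℝ≥0∞ :=
  ({z | z ∈ Θ ∧ (fiberPoly φ v y.2).eval z = y.1 ∧
    (fiberPoly φ v y.2).derivative.eval z ≠ 0}.encard : ℝ≥0∞)

theorem measurable_simpleCount {n : ℕ} (φ : Fin (n + 1) → ℂ[X]) (v : ℂ) {Θ : Set ℂ}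
    (hΘ : MeasurableSet Θ) : Measurable (simpleCount φ v Θ) := by
  have hg := contDiff_eval_fiberPoly φ v
  have hU : MeasurableSet {x : ℂ × (Fin n → ℂ) | x.1 ∈ Θ ∧
      (fiberPoly φ v x.2).derivative.eval x.1 ≠ 0} :=
    (measurable_fst hΘ).inter (isOpen_ne_fun (continuous_eval_derivative_fiberPoly φ v)
      continuous_const).measurableSet
  convert measurable_encard_inter_fiber (hg.continuous.prodMk continuous_snd) hU fun x hx =>
    exists_isOpen_injOn_prodMk_snd hg ((fiberPoly φ v x.2).hasDerivAt x.1) hx.2 using 2 with y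
  -- `z ↦ (z, t)` identifies the roots counted with a fibre of `(z, t) ↦ (p_t(z), t)`.
  rw [simpleCount, ← (Prod.mk_left_injective y.2).encard_image]
  congr 2
  ext ⟨z, t⟩
  simp only [Set.mem_image, Set.mem_ofPred_eq, Set.mem_inter_iff, Set.mem_preimage,
    Set.mem_singleton_iff, Prod.ext_iff]
  constructor
  · rintro ⟨z, ⟨h1, h2, h3⟩, rfl, rfl⟩
    exact ⟨⟨h1, h3⟩, h2, rfl⟩
  · rintro ⟨⟨h1, h3⟩, h2, rfl⟩
    exact ⟨z, ⟨h1, h2, h3⟩, rfl, rfl⟩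

theorem rootCount_eq_simpleCount {n : ℕ} {φ : Fin (n + 1) → ℂ[X]} (hφ0 : φ 0 = 1) {v : ℂ}
    {Ω : Type*} {η : Fin (n + 1) → Ω → ℂ} {ω : Ω}
    (h : ∀ z, (fiberPoly φ v fun j => η j.succ ω).eval z = η 0 ω →
      (fiberPoly φ v fun j => η j.succ ω).derivative.eval z ≠ 0) (Θ : Set ℂ) :
    (rootCount (randomPoly φ η ω) v Θ : ℝ≥0∞) =
      simpleCount φ v Θ (η 0 ω, fun j => η j.succ ω) := by
  have hq : randomPoly φ η ω - C v = C (η 0 ω) - fiberPoly φ v fun j => η j.succ ω := by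
    rw [randomPoly, fiberPoly, Fin.sum_univ_succ, hφ0]
    ring
  rw [rootCount, hq, Polynomial.card_roots_filter_eq_encard]
  · rw [simpleCount]
    congr 3
    ext z
    rw [eval_sub, eval_C, sub_eq_zero, derivative_sub, derivative_C, zero_sub, eval_neg, neg_ne_zero,
      eq_comm (a := η 0 ω)]
  · intro z hz
    rw [eval_sub, eval_C, sub_eq_zero] at hz
    simpa using h z hz.symm

theorem stdComplexNormal_absolutelyContinuous : stdComplexNormal ≪ volume :=
  withDensity_absolutelyContinuous _ _

theorem ae_eval_derivative_fiberPoly_ne_zero {n : ℕ} (φ : Fin (n + 1) → ℂ[X]) (v : ℂ)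
    (μ : Measure (Fin n → ℂ)) [SFinite μ] :
    ∀ᵐ y ∂stdComplexNormal.prod μ, ∀ z, (fiberPoly φ v y.2).eval z = y.1 →
      (fiberPoly φ v y.2).derivative.eval z ≠ 0 := by
  set F : ℂ × (Fin n → ℂ) → ℂ × (Fin n → ℂ) := fun x => ((fiberPoly φ v x.2).eval x.1, x.2) with hF
  set A : Set (ℂ × (Fin n → ℂ)) := {x | (fiberPoly φ v x.2).derivative.eval x.1 = 0} with hA
  have hFc : Continuous F := (contDiff_eval_fiberPoly φ v).continuous.prodMk continuous_snd
  have hAc : IsClosed A :=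
    isClosed_eq (continuous_eval_derivative_fiberPoly φ v) continuous_const
  have hm : MeasurableSet (F '' A) := by
    -- A closed set here is σ-compact, so its continuous image is Borel.
    obtain ⟨K, hK, hKA⟩ := isSigmaCompact_univ.of_isClosed_subset hAc (Set.subset_univ _)
    rw [← hKA, Set.image_iUnion]
    exact .iUnion fun i => ((hK i).image hFc).isClosed.measurableSet
  have h0 : stdComplexNormal.prod μ (F '' A) = 0 := by
    rw [Measure.prod_apply_symm hm, lintegral_eq_zero_iff (measurable_measure_prodMk_right hm)]
    refine .of_forall fun t => stdComplexNormal_absolutelyContinuous ?_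
    refine measure_mono_null ?_ (fiberPoly φ v t).volume_critical_values
    rintro w ⟨⟨z, t'⟩, hz, hzw⟩
    obtain ⟨h1, rfl⟩ := Prod.ext_iff.1 hzw
    exact ⟨z, hz, h1⟩
  filter_upwards [measure_eq_zero_iff_ae_notMem.1 h0] with y hy z hz hz'
  exact hy ⟨(z, y.2), hz', Prod.ext hz rfl⟩

/-! ### The density and the expected count -/

/-- The index `0` adds `1` to `K_n` and nothing to the kernels with derivatives. The `0 +` is the
value `c = 0` in the regression identity. -/
theorem rootDensity_eq {n : ℕ} {φ : Fin (n + 1) → ℂ[X]} (hφ0 : φ 0 = 1) (v z : ℂ) :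
    rootDensity φ v z =
      (∑ j : Fin n, ‖(φ j.succ).derivative.eval z‖ ^ 2 -
        ‖∑ j : Fin n, (φ j.succ).derivative.eval z * conj ((φ j.succ).eval z)‖ ^ 2 /
          (1 + ∑ j : Fin n, ‖(φ j.succ).eval z‖ ^ 2) +
        ‖0 + (∑ j : Fin n, (φ j.succ).derivative.eval z * conj ((φ j.succ).eval z)) /
          ((1 + ∑ j : Fin n, ‖(φ j.succ).eval z‖ ^ 2 : ℝ) : ℂ) * v‖ ^ 2) *
        gaussDensity (1 + ∑ j : Fin n, ‖(φ j.succ).eval z‖ ^ 2) v := by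
  have h0 : (kernel φ z z).re = 1 + ∑ j : Fin n, ‖(φ j.succ).eval z‖ ^ 2 := by
    simp [kernel, kernelDeriv, Fin.sum_univ_succ, hφ0, Complex.mul_conj, Complex.normSq_eq_norm_sq,
      -Complex.mul_re, -Complex.ofReal_pow]
  have h1 : (kernelDeriv φ 1 1 z z).re = ∑ j : Fin n, ‖(φ j.succ).derivative.eval z‖ ^ 2 := by
    simp [kernelDeriv, Fin.sum_univ_succ, hφ0, Complex.mul_conj, Complex.normSq_eq_norm_sq,
      -Complex.mul_re, -Complex.ofReal_pow]
  have h2 : ‖kernelDeriv φ 0 1 z z‖ =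
      ‖∑ j : Fin n, (φ j.succ).derivative.eval z * conj ((φ j.succ).eval z)‖ := by
    rw [← Complex.norm_conj]
    simp [kernelDeriv, Fin.sum_univ_succ, hφ0, mul_comm]
  rw [rootDensity, h0, h1, h2, gaussDensity, zero_add, norm_mul, norm_div, Complex.norm_real]
  have hS : 0 < 1 + ∑ j : Fin n, ‖(φ j.succ).eval z‖ ^ 2 := by positivity
  rw [Real.norm_of_nonneg hS.le]
  field_simp
  ring

theorem rootDensity_nonneg {n : ℕ} {φ : Fin (n + 1) → ℂ[X]} (hφ0 : φ 0 = 1) (v z : ℂ) :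
    0 ≤ rootDensity φ v z := by
  have hS : 0 < 1 + ∑ j : Fin n, ‖(φ j.succ).eval z‖ ^ 2 := by positivity
  rw [rootDensity_eq hφ0]
  refine mul_nonneg (add_nonneg (sub_nonneg.2 ?_) (sq_nonneg _)) (gaussDensity_nonneg hS v)
  rw [div_le_iff₀ hS]
  refine (norm_sum_mul_conj_sq_le _ _ _).trans ?_
  gcongr
  linarith

theorem measurable_rootDensity {n : ℕ} (φ : Fin (n + 1) → ℂ[X]) (v : ℂ) :
    Measurable (rootDensity φ v) := by
  have h : ∀ k l, Continuous fun z => kernelDeriv φ k l z z := fun k l => by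
    unfold kernelDeriv
    fun_prop
  have h00 := (h 0 0).measurable
  have h01 := (h 0 1).measurable
  have h11 := (h 1 1).measurable
  unfold rootDensity kernel
  fun_prop

/-- The expected number of simple roots, in the form of a Lebesgue integral. -/
theorem lintegral_simpleCount {n : ℕ} {φ : Fin (n + 1) → ℂ[X]} (hφ0 : φ 0 = 1) (v : ℂ)
    {Θ : Set ℂ} (hΘ : MeasurableSet Θ) :
    ∫⁻ y, simpleCount φ v Θ y
        ∂stdComplexNormal.prod (Measure.pi fun _ : Fin n => stdComplexNormal) =
      ∫⁻ z in Θ, ENNReal.ofReal (rootDensity φ v z) := by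
  have hp := measurable_ofReal_gaussDensity 1
  rw [lintegral_prod_symm' _ (measurable_simpleCount φ v hΘ)]
  have h1 : ∀ t : Fin n → ℂ, ∫⁻ w, simpleCount φ v Θ (w, t) ∂stdComplexNormal =
      ∫⁻ z in Θ, ENNReal.ofReal (‖(fiberPoly φ v t).derivative.eval z‖ ^ 2 *
        gaussDensity 1 ((fiberPoly φ v t).eval z)) := by
    intro t
    rw [stdComplexNormal_eq, lintegral_withDensity_eq_lintegral_mul _ hp
      (g := fun w => simpleCount φ v Θ (w, t)) ((measurable_simpleCount φ v hΘ).comp measurable_prodMk_right)]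
    simp_rw [ENNReal.ofReal_mul (sq_nonneg ‖_‖)]
    rw [← Polynomial.lintegral_encard_simple_roots_mul _ hΘ hp]
    exact lintegral_congr fun w => mul_comm _ _
  simp_rw [h1]
  -- After Tonelli, the regression identity applies with `a_j = φ_j(z)`, `b_j = φ_j'(z)`, `c = 0`,
  -- `u = v`.
  rw [lintegral_lintegral_swap]
  · refine lintegral_congr fun z => ?_
    rw [rootDensity_eq hφ0, ← lintegral_pi_affine_mul_gaussDensity]
    simp_rw [eval_fiberPoly, eval_derivative_fiberPoly, norm_neg, zero_add]
  · have h2 := (continuous_eval_derivative_fiberPoly φ v).comp continuous_swap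
    have h3 := (contDiff_eval_fiberPoly φ v).continuous.comp continuous_swap
    have h4 := continuous_gaussDensity 1
    exact ((h2.norm.pow 2).mul (h4.comp h3)).measurable.ennreal_ofReal.aemeasurable

theorem rootCount_le {Ω : Type*} {n : ℕ} {φ : Fin (n + 1) → ℂ[X]}
    (hdeg : ∀ j : Fin (n + 1), (φ j).natDegree ≤ j) (η : Fin (n + 1) → Ω → ℂ) (ω : Ω) (v : ℂ)
    (Θ : Set ℂ) : rootCount (randomPoly φ η ω) v Θ ≤ n := by
  classical
  rw [rootCount]
  refine (Multiset.card_le_card (Multiset.filter_le _ _)).trans ((card_roots' _).trans ?_)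
  rw [natDegree_sub_C]
  refine natDegree_sum_le_of_forall_le _ _ fun j _ => ?_
  exact (natDegree_C_mul_le _ _).trans ((hdeg j).trans (Nat.lt_succ_iff.1 j.2))

theorem hasLaw_prod_pi {Ω : Type*} [MeasurableSpace Ω] {P : Measure Ω} [IsProbabilityMeasure P]
    {n : ℕ} {η : Fin (n + 1) → Ω → ℂ} (hlaw : ∀ j, HasLaw (η j) stdComplexNormal P)
    (hindep : iIndepFun η P) :
    HasLaw (fun ω => (η 0 ω, fun j : Fin n => η j.succ ω))
      (stdComplexNormal.prod (Measure.pi fun _ : Fin n => stdComplexNormal)) P := by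
  have hm := fun j => (hlaw j).aemeasurable
  have hmp := measurePreserving_piFinSuccAbove (fun _ : Fin (n + 1) => stdComplexNormal) 0
  have hpi : P.map (fun ω j => η j ω) = Measure.pi fun _ => stdComplexNormal := by
    rw [hindep.map_fun_eq_pi_map hm]
    simp_rw [fun j => (hlaw j).map_eq]
  refine ⟨(hm 0).prodMk (aemeasurable_pi_lambda _ fun j => hm j.succ), ?_⟩
  rw [← hmp.map_eq, ← hpi, AEMeasurable.map_map_of_aemeasurable hmp.measurable.aemeasurable
    (aemeasurable_pi_lambda _ hm)]
  rfl

theorem theorem1p3 {Ω : Type*} [MeasurableSpace Ω] (P : Measure Ω) [IsProbabilityMeasure P]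
    (n : ℕ) (φ : Fin (n + 1) → ℂ[X])
    (hdeg : ∀ j : Fin (n + 1), (φ j).natDegree = (j : ℕ)) (hφ0 : φ 0 = 1)
    (η : Fin (n + 1) → Ω → ℂ)
    (hlaw : ∀ j, HasLaw (η j) stdComplexNormal P) (hindep : iIndepFun η P)
    (v : ℂ) (Θ : Set ℂ) (hopen : IsOpen Θ) (hconn : IsConnected Θ) :
    Integrable (fun ω => (rootCount (randomPoly φ η ω) v Θ : ℝ)) P ∧
      IntegrableOn (rootDensity φ v) Θ volume ∧
      ∫ ω, (rootCount (randomPoly φ η ω) v Θ : ℝ) ∂P = ∫ z in Θ, rootDensity φ v z := by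
  have hX := hasLaw_prod_pi hlaw hindep
  have hsc := measurable_simpleCount φ v hopen.measurableSet
  have hae : ∀ᵐ ω ∂P, (rootCount (randomPoly φ η ω) v Θ : ℝ≥0∞) =
      simpleCount φ v Θ (η 0 ω, fun j => η j.succ ω) := by
    have h := ae_eval_derivative_fiberPoly_ne_zero φ v
      (Measure.pi fun _ : Fin n => stdComplexNormal)
    rw [← hX.map_eq] at h
    filter_upwards [ae_of_ae_map hX.aemeasurable h] with ω hω
    exact rootCount_eq_simpleCount hφ0 hω Θ
  have hlin : ∫⁻ ω, (rootCount (randomPoly φ η ω) v Θ : ℝ≥0∞) ∂P =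
      ∫⁻ z in Θ, ENNReal.ofReal (rootDensity φ v z) := by
    rw [lintegral_congr_ae hae, ← lintegral_simpleCount hφ0 v hopen.measurableSet, ← hX.map_eq,
      lintegral_map' hsc.aemeasurable hX.aemeasurable]
  have hmeas : AEMeasurable (fun ω => (rootCount (randomPoly φ η ω) v Θ : ℝ)) P :=
    (hsc.comp_aemeasurable hX.aemeasurable).ennreal_toReal.congr <| by
      filter_upwards [hae] with ω hω
      simp [← hω]
  have hint : Integrable (fun ω => (rootCount (randomPoly φ η ω) v Θ : ℝ)) P := by
    refine .of_bound hmeas.aestronglyMeasurable n (.of_forall fun ω => ?_)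
    simpa using rootCount_le (fun j => (hdeg j).le) η ω v Θ
  have hofReal : ∀ ω, ENNReal.ofReal (rootCount (randomPoly φ η ω) v Θ : ℝ) =
      (rootCount (randomPoly φ η ω) v Θ : ℝ≥0∞) := fun ω => ENNReal.ofReal_natCast _
  have hnn : 0 ≤ rootDensity φ v := rootDensity_nonneg hφ0 v
  have hρ := measurable_rootDensity φ v
  refine ⟨hint, ⟨hρ.aestronglyMeasurable, ?_⟩, ?_⟩
  -- Finiteness is inherited from the bounded root count through `hlin`.
  · rw [hasFiniteIntegral_iff_ofReal (.of_forall hnn), ← hlin]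
    simp_rw [← hofReal]
    exact (hasFiniteIntegral_iff_ofReal (.of_forall fun ω => Nat.cast_nonneg _)).1 hint.2
  · rw [integral_eq_lintegral_of_nonneg_ae (.of_forall fun ω => Nat.cast_nonneg _)
      hmeas.aestronglyMeasurable,
      integral_eq_lintegral_of_nonneg_ae (.of_forall hnn) hρ.aestronglyMeasurable, ← hlin]
    simp_rw [hofReal]
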